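/- **Notation.** For a distance function $\rho : X\times X\to[0,\infty)$, a set $A\subseteq X$ is an $\varepsilon$-net of $(X,\rho)$ if the open balls $\{x : \rho(a,x)<\varepsilon\}$, $a\in A$, cover $X$, and an $r$-packing if the open balls $\{x:\rho(a,x)<r\}$, $a\in A$, are pairwise disjoint (an $\varepsilon$-net which is an $\varepsilon/2$-packing is a minimal $\varepsilon$-net). For a homeomorphism $\eta$ of $[0,\infty)$, an injection $f:(X,\rho)\to(Y,\sigma)$ is $\eta$-quasisymmetric if $\frac{\sigma(f(x),f(a))}{\sigma(f(x),f(b))}\le\eta\left(\frac{\rho(x,a)}{\rho(x,b)}\right)$ for all distinct $x,a,b\in X$. A bijection $f:(X,\rho)\to (Y,\sigma)$ is a *sampling equivalence* with data $(\eta,\eta',L,p)$ if $f$ is $\eta$-quasisymmetric, $f^{-1}$ is $\eta'$-quasisymmetric, and, for all $A\subseteq X$ and all $\varepsilon,r\ge0$: * if $A$ is an $\varepsilon$-net of $X$, then $f(A)$ is an $L\varepsilon^{p}$-net of $Y$; if $f(A)$ is an $\varepsilon$-net of $Y$, then $A$ is an $L\varepsilon^{1/p}$-net of $X$; * if $A$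 is an $r$-packing of $X$, then $f(A)$ is an $L^{-1}r^{p}$-packing of $Y$; if $f(A)$ is an $r$-packing of $Y$, then $A$ is an $L^{-1}r^{1/p}$-packing of $X$. A metric measure space $(X,d,\mu)$ ($\mu$ a Borel measure) is Ahlfors $\alpha$-regular with constant $C_0$ if $C_0^{-1}R^\alpha\le\mu(B[x,R])\le C_0R^\alpha$ for all $x\in X$ and all real $0<R\le\operatorname{diam}X$, where $B[x,R]$ is the closed ball. For $s>0$ let $q_{\mu,s}(x,y)=\big(\mu(B[x,d(x,y)])+\mu(B[y,d(x,y)])\big)^s$. **Theorem.** Let $\alpha>0$, $C_0>0$ and $0<\theta<1$. There are $N\in\mathbb{N}$, homeomorphisms $\eta,\eta'$ of $[0,\infty)$ and $L>0$, all depending only on $\alpha,C_0,\theta$, and, for every $s>0$ and $C\ge1$, homeomorphisms $\eta_{s,C},\eta'_{s,C}$ of $[0,\infty)$ and $L_{s,C}>0$, depending only on $\alpha,C_0,\theta,s,C$, such that for every metric measure space $(X,d,\mu)$ that is Ahlfors $\alpha$-regular with constant $C_0$ there are a subset $Y\subseteq\mathbb{R}^N$ (with the Euclidean metric) and a bijection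 $f:X\to Y$ with the following properties. 1. $f:(X,d)\to Y$ is a sampling equivalence with data $(\eta,\eta',L,\theta)$. 2. If $X$ has at least two points, then for every $s>0$, every $C\ge1$ and every $\rho:X\times X\to[0,\infty)$ with $C^{-1}q_{\mu,s}\le\rho\le C\,q_{\mu,s}$ (for example $\rho=q_{\mu,s}$, or any metric $D_{\mu,s}$ on $X$ that is $C$-bilipschitz equivalent to $q_{\mu,s}$), the same $f:(X,\rho)\to Y$ is a sampling equivalence with data $(\eta_{s,C},\eta'_{s,C},L_{s,C},\theta/(\alpha s))$. -/

import Mathlib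

open MeasureTheory
open scoped NNReal ENNReal

/-- The metric measure space `(X, d, μ)` is Ahlfors `α`-regular with constant `C₀`:
`C₀⁻¹ R ^ α ≤ μ (B[x, R]) ≤ C₀ R ^ α` for all `x` and all real `0 < R ≤ diam X`, where the diameter
is `∞` if `X` is unbounded. (A measure on the Borel `σ`-algebra is Borel regular as an outer
measure.) -/
def IsAhlforsRegular {X : Type*} [MetricSpace X] [MeasurableSpace X]
    (μ : Measure X) (α : ℝ) (C₀ : ℝ≥0) : Prop :=
  ∀ (x : X) (R : ℝ≥0), 0 < R → (R : ℝ≥0∞) ≤ Metric.ediam (Set.univ : Set X) →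
    ((C₀⁻¹ * R ^ α : ℝ≥0) : ℝ≥0∞) ≤ μ (Metric.closedBall x R) ∧
      μ (Metric.closedBall x R) ≤ ((C₀ * R ^ α : ℝ≥0) : ℝ≥0∞)

/-- The snowflaking operator: the quasimetric
`q_{μ,s}(x, y) = (μ (B[x, d(x, y)]) + μ (B[y, d(x, y)])) ^ s`. -/
noncomputable def measureQuasimetric {X : Type*} [MetricSpace X] [MeasurableSpace X]
    (μ : Measure X) (s : ℝ) (x y : X) : ℝ≥0 :=
  (μ (Metric.closedBall x (dist x y)) + μ (Metric.closedBall y (dist x y))).toNNReal ^ s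

/-- Two distance functions on `X` are bilipschitz equivalent with constant `C`. -/
def IsBilipEquiv {X : Type*} (C : ℝ≥0) (ρ q : X → X → ℝ≥0) : Prop :=
  ∀ x y : X, C⁻¹ * q x y ≤ ρ x y ∧ ρ x y ≤ C * q x y

/-- `f : (X, ρ) → (Y, σ)` is `η`-quasisymmetric, `η` being a homeomorphism of `[0, ∞)`. -/
def IsQuasisymmetric {X Y : Type*} (ρ : X → X → ℝ≥0) (σ : Y → Y → ℝ≥0)
    (η : ℝ≥0 ≃ₜ ℝ≥0) (f : X → Y) : Prop :=
  Function.Injective f ∧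
    ∀ x a b : X, x ≠ a → x ≠ b → a ≠ b →
      σ (f x) (f a) / σ (f x) (f b) ≤ η (ρ x a / ρ x b)

/-- `A` is an `ε`-net of `(X, ρ)`: the open `ε`-balls centred at the points of `A` cover `X`. -/
def IsNet {X : Type*} (ρ : X → X → ℝ≥0) (ε : ℝ≥0) (A : Set X) : Prop :=
  ∀ x : X, ∃ a ∈ A, ρ a x < ε

/-- The open `r`-balls of `(X, ρ)` centred at the points of `A` are pairwise disjoint. An `ε`-net
which has this property for `r = ε / 2` is a minimal `ε`-net (an efficient packing). -/
def IsPacking {X : Type*} (ρ : X → X → ℝ≥0) (r : ℝ≥0) (A : Set X) : Prop :=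
  A.PairwiseDisjoint (fun a => {x : X | ρ a x < r})

/-- The bijection `f : (X, ρ) → (Y, σ)` makes the sampling of `(X, ρ)` and that of `(Y, σ)`
quasisymmetrically equivalent, with quasisymmetry controls `η` (for `f`) and `η'` (for the
inverse), constant `L` and scale exponent `p`: nets and packings at scale `ε` correspond to each
other, the scales changing as `ε ↦ L ε ^ p`, `ε ↦ L⁻¹ ε ^ p` and, backwards, `ε ↦ L ε ^ (1 / p)`,
`ε ↦ L⁻¹ ε ^ (1 / p)`. Every subset of `Y` is of the form `f '' A`. -/
structure IsSamplingEquiv {X Y : Type*} (ρ : X → X → ℝ≥0) (σ : Y → Y → ℝ≥0)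
    (η η' : ℝ≥0 ≃ₜ ℝ≥0) (L : ℝ≥0) (p : ℝ) (f : X ≃ Y) : Prop where
  quasisymmetric : IsQuasisymmetric ρ σ η f
  quasisymmetric_symm : IsQuasisymmetric σ ρ η' f.symm
  net_image : ∀ (ε : ℝ≥0) (A : Set X), IsNet ρ ε A → IsNet σ (L * ε ^ p) (f '' A)
  net_of_image : ∀ (ε : ℝ≥0) (A : Set X), IsNet σ ε (f '' A) → IsNet ρ (L * ε ^ (1 / p)) A
  packing_image : ∀ (r : ℝ≥0) (A : Set X), IsPacking ρ r A → IsPacking σ (L⁻¹ * r ^ p) (f '' A)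
  packing_of_image : ∀ (r : ℝ≥0) (A : Set X),
    IsPacking σ r (f '' A) → IsPacking ρ (L⁻¹ * r ^ (1 / p)) A

/-!
The map `f` is an Assouad embedding: `‖f x - f y‖` is comparable to `d x y ^ θ`, with dimension and
constant depending on `α`, `C₀`, `θ` only (`exists_assouad_embedding`). Everything else follows
from comparability. If `σ (f x) (f y)` is comparable to `ρ x y ^ p`, then balls of radius `r`
correspond to balls of radius about `r ^ p`, and ratios of distances are distorted in a controlled
way, so that `f` is a sampling equivalence with exponent `p` (`isSamplingEquiv_of_comparable`).
Ahlfors regularity makes `q_{μ,s}` comparable to `d ^ (α * s)`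
(`IsAhlforsRegular.measureQuasimetric_comparable`), so `d ^ θ` is comparable to
`ρ ^ (θ / (α * s))` for every `ρ` comparable to `q_{μ,s}`, and the same `f` serves all of these `ρ`.

For the embedding, a volume count bounds the number of `r`-separated points in a ball of radius
`9 * r` by some `k` (`IsAhlforsRegular.hasPackingBound`). Hence a maximal `r`-separated set splits
into `k` classes that are `9 * r`-separated, and the truncated distances to these classes are `k`
bounded functions with Lipschitz constant `r⁻¹`, one of which separates `x` from `y` whenever
`3 * r ≤ d x y < 6 * r` (`HasPackingBound.exists_bumps`). The scales are `r = 2 ^ j`, `j ∈ ℤ`. For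
each residue of `j` modulo `m` and each class, the bumps are added up with the weights `r ^ θ`.
In the increment of such a sum between `x` and `y`, the scales far finer than `d x y` are damped
by the factor `r ^ θ`, and those far coarser by `r ^ (θ - 1)`. Since `0 < θ < 1`, both contributions
decay geometrically, and for `m` large they do not spoil the term of the scale comparable to
`d x y` (`exists_scale_superposition`, `HasPackingBound.exists_coordinates`).
-/

/-! ### Snowflake comparability implies sampling equivalence -/

/-- The homeomorphism `t ↦ c * t ^ p` of `[0, ∞)`. -/
noncomputable def powerHomeomorph (c : ℝ≥0) (hc : 0 < c) (p : ℝ) (hp : 0 < p) : ℝ≥0 ≃ₜ ℝ≥0 :=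
  (NNReal.orderIsoRpow p hp).toHomeomorph.trans (Homeomorph.mulLeft₀ c hc.ne')

lemma powerHomeomorph_apply (c : ℝ≥0) (hc : 0 < c) (p : ℝ) (hp : 0 < p) (t : ℝ≥0) :
    powerHomeomorph c hc p hp t = c * t ^ p := rfl

lemma NNReal.div_le_sq_mul_div {K a b u v : ℝ≥0} (hK : 0 < K)
    (hu : u ≤ K * a) (hv : K⁻¹ * b ≤ v) (hb : b = 0 → v = 0) :
    u / v ≤ K ^ 2 * (a / b) := by
  rcases eq_or_ne b 0 with h0 | h0
  · simp [hb h0]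
  · have hb0 : 0 < b := pos_iff_ne_zero.2 h0
    calc u / v ≤ (K * a) / (K⁻¹ * b) := by gcongr
      _ = K ^ 2 * (a / b) := by field_simp

lemma NNReal.rpow_comparable_symm {K a b : ℝ≥0} {p : ℝ} (hK : 0 < K) (hp : 0 < p)
    (h₁ : K⁻¹ * a ^ p ≤ b) (h₂ : b ≤ K * a ^ p) :
    (K ^ (1 / p))⁻¹ * b ^ (1 / p) ≤ a ∧ a ≤ K ^ (1 / p) * b ^ (1 / p) := by
  have hp' : 0 ≤ 1 / p := by positivity
  have e : ∀ t : ℝ≥0, (t ^ p) ^ (1 / p) = t := fun t => by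
    rw [← NNReal.rpow_mul, mul_one_div_cancel hp.ne', NNReal.rpow_one]
  constructor
  · rw [inv_mul_le_iff₀ (by positivity)]
    calc b ^ (1 / p) ≤ (K * a ^ p) ^ (1 / p) := NNReal.rpow_le_rpow h₂ hp'
      _ = _ := by rw [NNReal.mul_rpow, e]
  · rw [inv_mul_le_iff₀ hK] at h₁
    calc a = (a ^ p) ^ (1 / p) := (e a).symm
      _ ≤ (K * b) ^ (1 / p) := NNReal.rpow_le_rpow h₁ hp'
      _ = _ := NNReal.mul_rpow

section Transfer

variable {X Y : Type*} {ρ : X → X → ℝ≥0} {σ : Y → Y → ℝ≥0} {K : ℝ≥0} {p : ℝ} {f : X ≃ Y}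

lemma isQuasisymmetric_of_comparable (hK : 0 < K) (hp : 0 < p)
    (h : ∀ x y, K⁻¹ * ρ x y ^ p ≤ σ (f x) (f y) ∧ σ (f x) (f y) ≤ K * ρ x y ^ p) :
    IsQuasisymmetric ρ σ (powerHomeomorph (K ^ 2) (by positivity) p hp) f := by
  refine ⟨f.injective, fun x a b _ _ _ => ?_⟩
  rw [powerHomeomorph_apply, NNReal.div_rpow]
  refine NNReal.div_le_sq_mul_div hK (h x a).2 (h x b).1 fun h0 => ?_
  have := (h x b).2
  rwa [h0, mul_zero, nonpos_iff_eq_zero] at this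

lemma IsNet.image_of_comparable {L ε : ℝ≥0} {A : Set X} (hK : 0 < K) (hp : 0 < p) (hL : K ≤ L)
    (h : ∀ x y, σ (f x) (f y) ≤ K * ρ x y ^ p) (hA : IsNet ρ ε A) :
    IsNet σ (L * ε ^ p) (f '' A) := by
  intro y
  obtain ⟨a, ha, hay⟩ := hA (f.symm y)
  refine ⟨f a, ⟨a, ha, rfl⟩, ?_⟩
  have h1 := h a (f.symm y)
  rw [f.apply_symm_apply] at h1
  calc σ (f a) y ≤ K * ρ a (f.symm y) ^ p := h1
    _ < K * ε ^ p := by gcongr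
    _ ≤ L * ε ^ p := by gcongr

lemma IsPacking.image_of_comparable {L r : ℝ≥0} {A : Set X} (hK : 0 < K) (hp : 0 < p) (hL : K ≤ L)
    (h : ∀ x y, K⁻¹ * ρ x y ^ p ≤ σ (f x) (f y)) (hA : IsPacking ρ r A) :
    IsPacking σ (L⁻¹ * r ^ p) (f '' A) := by
  -- A point in the image ball around `f a` comes from the ball around `a`.
  have key : ∀ a y, σ (f a) y < L⁻¹ * r ^ p → ρ a (f.symm y) < r := by
    intro a y hy
    have h1 := h a (f.symm y)
    rw [f.apply_symm_apply] at h1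
    have h2 : K⁻¹ * ρ a (f.symm y) ^ p < K⁻¹ * r ^ p :=
      h1.trans_lt (hy.trans_le (by gcongr))
    exact (NNReal.rpow_lt_rpow_iff hp).1 (lt_of_mul_lt_mul_left' h2)
  rintro _ ⟨a, ha, rfl⟩ _ ⟨b, hb, rfl⟩ hab
  refine Set.disjoint_left.2 fun y hya hyb => ?_
  exact Set.disjoint_left.1 (hA ha hb fun e => hab (by rw [e])) (key a y hya) (key b y hyb)

/-- A bijection along which `σ` is comparable to the snowflake `ρ ^ p` is a sampling equivalence,
with data that depend on the comparability constant and on `p` only. -/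
lemma isSamplingEquiv_of_comparable (hK : 0 < K) (hp : 0 < p)
    (h : ∀ x y, K⁻¹ * ρ x y ^ p ≤ σ (f x) (f y) ∧ σ (f x) (f y) ≤ K * ρ x y ^ p) :
    IsSamplingEquiv ρ σ (powerHomeomorph (K ^ 2) (by positivity) p hp)
      (powerHomeomorph ((K ^ (1 / p)) ^ 2) (by positivity) (1 / p) (by positivity))
      (max K (K ^ (1 / p))) p f := by
  have hK' : 0 < K ^ (1 / p) := by positivity
  have hp' : 0 < 1 / p := by positivity
  have h' : ∀ u v, (K ^ (1 / p))⁻¹ * σ u v ^ (1 / p) ≤ ρ (f.symm u) (f.symm v) ∧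
      ρ (f.symm u) (f.symm v) ≤ K ^ (1 / p) * σ u v ^ (1 / p) := by
    intro u v
    have := h (f.symm u) (f.symm v)
    simp only [f.apply_symm_apply] at this
    exact NNReal.rpow_comparable_symm hK hp this.1 this.2
  refine ⟨isQuasisymmetric_of_comparable hK hp h, isQuasisymmetric_of_comparable hK' hp' h',
    fun ε A hA => hA.image_of_comparable hK hp (le_max_left _ _) fun x y => (h x y).2,
    fun ε A hA => ?_,
    fun r A hA => hA.image_of_comparable hK hp (le_max_left _ _) fun x y => (h x y).1,
    fun r A hA => ?_⟩
  · have := hA.image_of_comparable hK' hp' (le_max_right K _) fun u v => (h' u v).2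
    rwa [f.symm_image_image] at this
  · have := hA.image_of_comparable hK' hp' (le_max_right K _) fun u v => (h' u v).1
    rwa [f.symm_image_image] at this

end Transfer

/-! ### Packing bounds in Ahlfors regular spaces -/

/-- Every `r`-separated finite subset of an open ball of radius `9 * r` has at most `k` points. -/
def HasPackingBound (X : Type*) [MetricSpace X] (k : ℕ) : Prop :=
  ∀ (r : ℝ) (a : X) (F : Finset X), 0 < r →
    (F : Set X).Pairwise (fun x y => r ≤ dist x y) → (∀ x ∈ F, dist x a < 9 * r) → F.card ≤ k

section Ahlfors

variable {X : Type*} [MetricSpace X] [MeasurableSpace X] {μ : Measure X} {α : ℝ} {C₀ : ℝ≥0}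

/-- Ahlfors regularity gives the upper bound for radii beyond the diameter as well, since such a
ball is the ball of radius `diam X`. -/
lemma IsAhlforsRegular.measure_closedBall_le [Nontrivial X] (h : IsAhlforsRegular μ α C₀)
    (hα : 0 < α) (x : X) (R : ℝ≥0) (hR : 0 < R) :
    μ (Metric.closedBall x R) ≤ ((C₀ * R ^ α : ℝ≥0) : ℝ≥0∞) := by
  rcases le_or_gt (R : ℝ≥0∞) (Metric.ediam (Set.univ : Set X)) with hle | hlt
  · exact (h x R hR hle).2
  · lift Metric.ediam (Set.univ : Set X) to ℝ≥0 using hlt.ne_top with D hD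
    have hD0 : 0 < D := by
      obtain ⟨y, hy⟩ := exists_ne x
      have : edist x y ≤ (D : ℝ≥0∞) := by
        rw [hD]; exact Metric.edist_le_ediam_of_mem (Set.mem_univ _) (Set.mem_univ _)
      rw [← ENNReal.coe_pos]
      exact (edist_pos.2 hy.symm).trans_le this
    have hsub : Metric.closedBall x R ⊆ Metric.closedBall x D := by
      intro y _
      have : edist y x ≤ (D : ℝ≥0∞) := by
        rw [hD]; exact Metric.edist_le_ediam_of_mem (Set.mem_univ _) (Set.mem_univ _)
      rw [Metric.mem_closedBall]
      rw [edist_nndist] at this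
      exact_mod_cast this
    have hDR : D ≤ R := by exact_mod_cast hlt.le
    refine (measure_mono hsub).trans ((h x D hD0 hD.le).2.trans ?_)
    gcongr

/-- An Ahlfors regular space satisfies a packing bound: the disjoint balls of radius `r / 3` around
an `r`-separated set share the mass of a ball of radius `10 * r`. -/
lemma IsAhlforsRegular.hasPackingBound [BorelSpace X] (h : IsAhlforsRegular μ α C₀)
    (hα : 0 < α) (hC₀ : 0 < C₀) : HasPackingBound X (⌈C₀ ^ 2 * 30 ^ α⌉₊ + 1) := by
  intro r a F hr hF hFa
  rcases le_or_gt F.card 1 with h1 | h1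
  · omega
  obtain ⟨u, hu, v, hv, huv⟩ := Finset.one_lt_card.1 h1
  have : Nontrivial X := ⟨u, v, huv⟩
  lift r to ℝ≥0 using hr.le
  have hr : 0 < r := by exact_mod_cast hr
  have hdiam : ((r / 3 : ℝ≥0) : ℝ≥0∞) ≤ Metric.ediam (Set.univ : Set X) := by
    refine le_trans ?_ (Metric.edist_le_ediam_of_mem (Set.mem_univ u) (Set.mem_univ v))
    rw [edist_nndist, ENNReal.coe_le_coe]
    refine (div_le_self zero_le (by norm_num)).trans ?_
    exact_mod_cast hF hu hv huv
  have hdisj : (F : Set X).PairwiseDisjoint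
      (fun x => Metric.closedBall x ((r / 3 : ℝ≥0) : ℝ)) := by
    intro x hx y hy hxy
    refine Metric.closedBall_disjoint_closedBall ?_
    have h2 : (0 : ℝ) < r := by exact_mod_cast hr
    have h3 := hF hx hy hxy
    push_cast
    simp only at h3
    linarith
  have hsub : (⋃ x ∈ F, Metric.closedBall x ((r / 3 : ℝ≥0) : ℝ)) ⊆
      Metric.closedBall a ((10 * r : ℝ≥0) : ℝ) := by
    refine Set.iUnion₂_subset fun x hx => Metric.closedBall_subset_closedBall' ?_
    have h2 : (0 : ℝ) < r := by exact_mod_cast hr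
    have := hFa x hx
    push_cast
    linarith
  have hsum : (F.card : ℝ≥0∞) * ((C₀⁻¹ * (r / 3) ^ α : ℝ≥0) : ℝ≥0∞) ≤
      ((C₀ * (10 * r) ^ α : ℝ≥0) : ℝ≥0∞) := by
    calc (F.card : ℝ≥0∞) * ((C₀⁻¹ * (r / 3) ^ α : ℝ≥0) : ℝ≥0∞)
        = ∑ _x ∈ F, ((C₀⁻¹ * (r / 3) ^ α : ℝ≥0) : ℝ≥0∞) := by
          rw [Finset.sum_const, nsmul_eq_mul]
      _ ≤ ∑ x ∈ F, μ (Metric.closedBall x ((r / 3 : ℝ≥0) : ℝ)) :=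
          Finset.sum_le_sum fun x _ => (h x _ (by positivity) hdiam).1
      _ = μ (⋃ x ∈ F, Metric.closedBall x ((r / 3 : ℝ≥0) : ℝ)) :=
          (measure_biUnion_finset hdisj fun x _ => Metric.isClosed_closedBall.measurableSet).symm
      _ ≤ μ (Metric.closedBall a ((10 * r : ℝ≥0) : ℝ)) := measure_mono hsub
      _ ≤ _ := h.measure_closedBall_le hα a _ (by positivity)
  have hsum' : (F.card : ℝ≥0) * (C₀⁻¹ * (r / 3) ^ α) ≤ C₀ * (10 * r) ^ α := by
    exact_mod_cast hsum
  have hr30 : (10 * r) ^ α = 30 ^ α * (r / 3) ^ α := by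
    rw [← NNReal.mul_rpow]
    congr 1
    field_simp
    norm_num
  have hcard : (F.card : ℝ≥0) ≤ C₀ ^ 2 * 30 ^ α := by
    have hpos : 0 < C₀⁻¹ * (r / 3) ^ α := by positivity
    refine le_of_mul_le_mul_right (hsum'.trans_eq ?_) hpos
    rw [hr30]
    field_simp
  have : F.card ≤ ⌈C₀ ^ 2 * 30 ^ α⌉₊ := by exact_mod_cast hcard.trans (Nat.le_ceil _)
  omega

/-- The snowflaking quasimetric `q_{μ,s}` is comparable to `d ^ (α * s)`. -/
lemma IsAhlforsRegular.measureQuasimetric_comparable [Nontrivial X] (h : IsAhlforsRegular μ α C₀)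
    (hα : 0 < α) {s : ℝ} (hs : 0 < s) (x y : X) :
    (2 * C₀⁻¹) ^ s * nndist x y ^ (α * s) ≤ measureQuasimetric μ s x y ∧
      measureQuasimetric μ s x y ≤ (2 * C₀) ^ s * nndist x y ^ (α * s) := by
  set d := nndist x y with hd
  have hα0 : α * s ≠ 0 := (mul_pos hα hs).ne'
  have hup : ∀ z : X, μ (Metric.closedBall z d) ≤ ((C₀ * d ^ α : ℝ≥0) : ℝ≥0∞) := by
    intro z
    rcases eq_or_ne d 0 with h0 | h0
    · -- Points are null sets, by the upper bound for arbitrarily small balls.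
      have hlim : Filter.Tendsto (fun R : ℝ≥0 => ((C₀ * R ^ α : ℝ≥0) : ℝ≥0∞))
          (nhdsWithin 0 (Set.Ioi 0)) (nhds ((C₀ * 0 ^ α : ℝ≥0) : ℝ≥0∞)) := by
        refine Filter.Tendsto.mono_left (Continuous.tendsto ?_ _) nhdsWithin_le_nhds
        exact ENNReal.continuous_coe.comp
          (continuous_const.mul (NNReal.continuous_rpow_const hα.le))
      rw [h0]
      refine ge_of_tendsto hlim ?_
      filter_upwards [self_mem_nhdsWithin] with R hR
      exact (measure_mono (Metric.closedBall_subset_closedBall (by simp))).trans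
        (h.measure_closedBall_le hα z R hR)
    · exact h.measure_closedBall_le hα z d (pos_iff_ne_zero.2 h0)
  have hlow : ∀ z : X, ((C₀⁻¹ * d ^ α : ℝ≥0) : ℝ≥0∞) ≤ μ (Metric.closedBall z d) := by
    intro z
    rcases eq_or_ne d 0 with h0 | h0
    · simp [h0, NNReal.zero_rpow hα.ne']
    · refine (h z d (pos_iff_ne_zero.2 h0) ?_).1
      rw [hd, ← edist_nndist]
      exact Metric.edist_le_ediam_of_mem (Set.mem_univ _) (Set.mem_univ _)
  have hpow : ∀ c : ℝ≥0, (2 * c) ^ s * d ^ (α * s) = (2 * (c * d ^ α)) ^ s := by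
    intro c
    rw [NNReal.rpow_mul, ← NNReal.mul_rpow, mul_assoc]
  have hfin : ∀ z : X, μ (Metric.closedBall z d) ≠ ∞ := fun z =>
    ((hup z).trans_lt ENNReal.coe_lt_top).ne
  have hq : measureQuasimetric μ s x y =
      ((μ (Metric.closedBall x d)).toNNReal + (μ (Metric.closedBall y d)).toNNReal) ^ s := by
    rw [measureQuasimetric, ← coe_nndist, ← hd, ENNReal.toNNReal_add (hfin x) (hfin y)]
  have hup' : ∀ z : X, (μ (Metric.closedBall z d)).toNNReal ≤ C₀ * d ^ α := fun z => by
    rw [← ENNReal.coe_le_coe, ENNReal.coe_toNNReal (hfin z)]; exact hup z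
  have hlow' : ∀ z : X, C₀⁻¹ * d ^ α ≤ (μ (Metric.closedBall z d)).toNNReal := fun z => by
    rw [← ENNReal.coe_le_coe, ENNReal.coe_toNNReal (hfin z)]; exact hlow z
  rw [hpow, hpow, hq]
  constructor <;> refine NNReal.rpow_le_rpow ?_ hs.le <;> rw [two_mul]
  · exact add_le_add (hlow' x) (hlow' y)
  · exact add_le_add (hup' x) (hup' y)

end Ahlfors

/-! ### Bump functions at a fixed scale -/

/-- Every set contains a maximal `r`-separated subset, which therefore is an `r`-net in it. -/
lemma exists_maximal_separated {X : Type*} [MetricSpace X] {r : ℝ} (hr : 0 < r) (S : Set X) :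
    ∃ A ⊆ S, A.Pairwise (fun x y => r ≤ dist x y) ∧ ∀ x ∈ S, ∃ a ∈ A, dist x a < r := by
  obtain ⟨A, hA⟩ := zorn_subset {A : Set X | A ⊆ S ∧ A.Pairwise (fun x y => r ≤ dist x y)} (by
    intro c hc hchain
    refine ⟨⋃₀ c, ⟨Set.sUnion_subset fun t ht => (hc ht).1, ?_⟩, fun s => Set.subset_sUnion_of_mem⟩
    exact (Set.pairwise_sUnion hchain.directedOn).2 fun t ht => (hc ht).2)
  refine ⟨A, hA.prop.1, hA.prop.2, fun x hx => ?_⟩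
  by_contra! hfar
  have hsep : (insert x A).Pairwise (fun x y => r ≤ dist x y) := by
    refine Set.pairwise_insert.2 ⟨hA.prop.2, fun b hb _ => ⟨hfar b hb, ?_⟩⟩
    rw [dist_comm]
    exact hfar b hb
  have hxA : x ∈ A :=
    hA.le_of_ge ⟨Set.insert_subset hx hA.prop.1, hsep⟩ (Set.subset_insert x A)
      (Set.mem_insert x A)
  have := hfar x hxA
  rw [dist_self] at this
  exact this.not_gt hr

/-- A maximal `r`-separated set splits into `k` classes that are `9 * r`-separated: extract
maximal `9 * r`-separated subsets one after the other. A point that survives `k` extractions is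
`9 * r`-close to a point of each class, against the packing bound. -/
lemma HasPackingBound.exists_classes {X : Type*} [MetricSpace X] {k : ℕ} (hk : HasPackingBound X k)
    {r : ℝ} (hr : 0 < r) :
    ∃ A : ℕ → Set X, (∀ c, (A c).Pairwise (fun x y => 9 * r ≤ dist x y)) ∧
      ∀ x, ∃ c < k, ∃ a ∈ A c, dist x a < r := by
  obtain ⟨N, -, hN, hNnet⟩ := exists_maximal_separated hr (Set.univ : Set X)
  choose M hMsub hMsep hMnet using exists_maximal_separated (X := X) (r := 9 * r) (by positivity)
  -- `S c` is what is left of `N` before the class number `c` is extracted.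
  let S : ℕ → Set X := fun c => Nat.rec N (fun _ T => T \ M T) c
  have hS : ∀ c, S (c + 1) = S c \ M (S c) := fun _ => rfl
  have hanti : Antitone S := antitone_nat_of_succ_le fun c => by
    rw [hS]; exact Set.sdiff_subset
  refine ⟨fun c => M (S c), fun c => hMsep _, fun x => ?_⟩
  obtain ⟨a, haN, hxa⟩ := hNnet x (Set.mem_univ x)
  by_contra! hno
  have hmem : ∀ c ≤ k, a ∈ S c := by
    intro c hc
    induction c with
    | zero => exact haN
    | succ c ih =>
      rw [hS]
      exact ⟨ih (by omega), fun ha => (hno c (by omega) a ha).not_gt hxa⟩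
  have hclose : ∀ c : Fin k, ∃ b ∈ M (S c), dist a b < 9 * r := fun c =>
    hMnet _ a (hmem c c.2.le)
  choose b hbM hab using hclose
  have hbne : ∀ c, b c ≠ a := fun c e =>
    (hno c c.2 (b c) (hbM c)).not_gt (by rwa [e])
  have hbinj : Function.Injective b := by
    have key : ∀ c c' : Fin k, c < c' → b c ≠ b c' := by
      intro c c' hcc e
      have h1 : b c' ∈ S (c + 1) := hanti (Nat.succ_le_of_lt hcc) (hMsub _ (hbM c'))
      rw [hS] at h1
      exact h1.2 (e ▸ hbM c)
    intro c c' e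
    rcases lt_trichotomy c c' with h | h | h
    · exact absurd e (key _ _ h)
    · exact h
    · exact absurd e.symm (key _ _ h)
  classical
  let F : Finset X := insert a (Finset.univ.image b)
  have hFN : (F : Set X) ⊆ N := by
    intro z hz
    rcases Finset.mem_insert.1 (Finset.mem_coe.1 hz) with rfl | hz
    · exact haN
    · obtain ⟨c, -, rfl⟩ := Finset.mem_image.1 hz
      exact hanti (Nat.zero_le _) (hMsub _ (hbM c))
  have hcard : F.card = k + 1 := by
    rw [Finset.card_insert_of_notMem, Finset.card_image_of_injective _ hbinj, Finset.card_univ,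
      Fintype.card_fin]
    intro ha
    obtain ⟨c, -, hc⟩ := Finset.mem_image.1 ha
    exact hbne c hc
  have := hk r a F hr (hN.mono hFN) fun z hz => by
    rcases Finset.mem_insert.1 hz with rfl | hz
    · rw [dist_self]; positivity
    · obtain ⟨c, -, rfl⟩ := Finset.mem_image.1 hz
      rw [dist_comm]; exact hab c
  omega

/-- At each scale `r` there are `k` bounded, `r⁻¹`-Lipschitz functions that separate any two points
at distance between `3 * r` and `6 * r`. They are truncations of the distances to the classes. -/
lemma HasPackingBound.exists_bumps {X : Type*} [MetricSpace X] {k : ℕ} (hk : HasPackingBound X k)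
    {r : ℝ} (hr : 0 < r) :
    ∃ g : Fin k → X → ℝ, (∀ c x y, |g c x - g c y| ≤ 2) ∧
      (∀ c x y, |g c x - g c y| ≤ dist x y / r) ∧
      ∀ x y, 3 * r ≤ dist x y → dist x y < 6 * r → ∃ c, 1 ≤ |g c x - g c y| := by
  obtain ⟨A, hAsep, hAnet⟩ := hk.exists_classes hr
  -- If a class is empty, then `infDist` is zero and the function is constant.
  refine ⟨fun c x => max 0 (2 - Metric.infDist x (A c) / r), fun c x y => ?_, fun c x y => ?_,
    fun x y h3 h6 => ?_⟩
  · have hle : ∀ z, max 0 (2 - Metric.infDist z (A c) / r) ≤ 2 := fun z => by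
      have : 0 ≤ Metric.infDist z (A c) / r := div_nonneg Metric.infDist_nonneg hr.le
      exact max_le (by norm_num) (by linarith)
    have hx := hle x
    have hy := hle y
    have hx0 := le_max_left 0 (2 - Metric.infDist x (A c) / r)
    have hy0 := le_max_left 0 (2 - Metric.infDist y (A c) / r)
    rw [abs_le]
    constructor <;> linarith
  · calc |max 0 (2 - Metric.infDist x (A c) / r) - max 0 (2 - Metric.infDist y (A c) / r)|
        ≤ |(2 - Metric.infDist x (A c) / r) - (2 - Metric.infDist y (A c) / r)| := by
          rw [max_comm 0, max_comm 0]; exact abs_max_sub_max_le_abs _ _ _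
      _ = |Metric.infDist x (A c) - Metric.infDist y (A c)| / r := by
          rw [← abs_of_pos hr, ← abs_div, abs_of_pos hr, abs_sub_comm]; congr 1; ring
      _ ≤ dist x y / r := by
          gcongr
          have := (Metric.lipschitz_infDist_pt (A c)).dist_le_mul x y
          rwa [NNReal.coe_one, one_mul, Real.dist_eq] at this
  · obtain ⟨c, hc, a, ha, hxa⟩ := hAnet x
    refine ⟨⟨c, hc⟩, ?_⟩
    have hx : Metric.infDist x (A c) / r ≤ 1 := by
      rw [div_le_one hr]
      exact (Metric.infDist_le_dist_of_mem ha).trans hxa.le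
    have hy : 2 ≤ Metric.infDist y (A c) / r := by
      rw [le_div_iff₀ hr]
      refine (Metric.le_infDist ⟨a, ha⟩).2 fun b hb => ?_
      rcases eq_or_ne a b with rfl | hab
      · have := dist_triangle x a y
        rw [dist_comm a y] at this
        linarith
      · have h1 := hAsep c ha hb hab
        have h2 := dist_triangle4 a x y b
        rw [dist_comm a x] at h2
        simp only at h1
        linarith
    simp only
    rw [max_eq_left (a := (0 : ℝ)) (b := 2 - Metric.infDist y (A c) / r) (by linarith), sub_zero]
    exact le_trans (le_trans (by linarith) (le_max_right _ _)) (le_abs_self _)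

/-! ### Superposition of the scales -/

lemma hasSum_pow_natAbs {q : ℝ} (hq0 : 0 ≤ q) (hq1 : q < 1) :
    HasSum (fun l : ℤ => q ^ l.natAbs) (1 + 2 * q / (1 - q)) := by
  have h1 : HasSum (fun n : ℕ => q ^ (n : ℤ).natAbs) (1 - q)⁻¹ := by
    simpa using hasSum_geometric_of_lt_one hq0 hq1
  have h2 : HasSum (fun n : ℕ => q ^ (-((n : ℤ) + 1)).natAbs) (q * (1 - q)⁻¹) := by
    have e : ∀ n : ℕ, (-((n : ℤ) + 1)).natAbs = n + 1 := fun n => by omega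
    simp only [e, pow_succ']
    exact (hasSum_geometric_of_lt_one hq0 hq1).mul_left q
  convert HasSum.of_nat_of_neg_add_one (f := fun l : ℤ => q ^ l.natAbs) h1 h2 using 1
  have : 1 - q ≠ 0 := by linarith
  field_simp
  ring

/-- A series over `ℤ` that decays geometrically away from the index `n₀` is summable and is close
to its term at `n₀`. -/
lemma summable_and_abs_tsum_sub_le {a : ℤ → ℝ} {q B : ℝ} {n₀ : ℤ} (hq0 : 0 ≤ q) (hq1 : q < 1)
    (ha : ∀ n, |a n| ≤ B * q ^ (n - n₀).natAbs) :
    Summable a ∧ |∑' n, a n - a n₀| ≤ B * (2 * q / (1 - q)) := by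
  have hb : HasSum (fun n : ℤ => B * q ^ (n - n₀).natAbs) (B * (1 + 2 * q / (1 - q))) := by
    refine HasSum.mul_left B ?_
    exact (Equiv.hasSum_iff (f := fun l : ℤ => q ^ l.natAbs) (Equiv.subRight n₀)).2
      (hasSum_pow_natAbs hq0 hq1)
  have hs : Summable a := Summable.of_norm_bounded hb.summable ha
  refine ⟨hs, ?_⟩
  have hs' := hs.hasSum.update n₀ 0
  have hb' := hb.update n₀ 0
  have hle : |0 - a n₀ + ∑' n, a n| ≤
      0 - B * q ^ (n₀ - n₀).natAbs + B * (1 + 2 * q / (1 - q)) := by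
    rw [← hs'.tsum_eq, ← Real.norm_eq_abs]
    refine tsum_of_norm_bounded hb' fun n => ?_
    rcases eq_or_ne n n₀ with rfl | hn
    · simp
    · rw [Function.update_of_ne hn, Function.update_of_ne hn]
      exact ha n
  have e1 : ∑' n, a n - a n₀ = 0 - a n₀ + ∑' n, a n := by ring
  rw [e1]
  refine hle.trans_eq ?_
  rw [sub_self, Int.natAbs_zero, pow_zero]
  ring

/-- The contribution of the scale `r₀ * Λ ^ n` to the difference between two points at distance `d`
decays geometrically in the distance of `n` from an index `n₀` whose scale is comparable to `d`:
the finer scales are small since the bumps are bounded, the coarser ones since the bumps are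
Lipschitz and `θ < 1`. -/
lemma scale_contribution_le {r₀ Λ θ q d t S : ℝ} (hr₀ : 0 < r₀) (hΛ : 0 < Λ) (hq : 0 < q)
    (hq₁ : 1 ≤ q * Λ ^ θ) (hq₂ : Λ ^ θ ≤ q * Λ) (n n₀ : ℤ) (ht2 : t ≤ 2)
    (htd : t ≤ d / (r₀ * Λ ^ n)) (hS : 2 ≤ S) (hd : d ≤ S * (r₀ * Λ ^ n₀)) :
    (r₀ * Λ ^ n) ^ θ * t ≤ S * (r₀ * Λ ^ n₀) ^ θ * q ^ (n - n₀).natAbs := by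
  have hpow : ∀ (j : ℤ) (l : ℕ),
      (r₀ * Λ ^ (j + l)) ^ θ = (r₀ * Λ ^ j) ^ θ * (Λ ^ θ) ^ l := by
    intro j l
    rw [zpow_add₀ hΛ.ne', zpow_natCast, ← mul_assoc,
      Real.mul_rpow (by positivity) (by positivity), ← Real.rpow_natCast Λ, ← Real.rpow_mul hΛ.le,
      mul_comm (l : ℝ), Real.rpow_mul hΛ.le, Real.rpow_natCast]
  rcases le_total n n₀ with h | h
  · obtain ⟨l, rfl⟩ := Int.le.dest h
    have e : (n - (n + l)).natAbs = l := by omega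
    rw [e, hpow]
    have h1 : 1 ≤ (q * Λ ^ θ) ^ l := one_le_pow₀ hq₁
    calc (r₀ * Λ ^ n) ^ θ * t ≤ (r₀ * Λ ^ n) ^ θ * (S * (q * Λ ^ θ) ^ l) := by
          gcongr
          nlinarith
      _ = _ := by rw [mul_pow]; ring
  · obtain ⟨l, rfl⟩ := Int.le.dest h
    have e : (n₀ + l - n₀).natAbs = l := by omega
    rw [e, hpow]
    have h2 : t ≤ S / Λ ^ l := by
      refine htd.trans ?_
      rw [zpow_add₀ hΛ.ne', zpow_natCast, ← mul_assoc, div_le_div_iff₀ (by positivity)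
        (by positivity), ← mul_assoc]
      gcongr
    have h3 : (Λ ^ θ) ^ l ≤ q ^ l * Λ ^ l := by
      rw [← mul_pow]
      exact pow_le_pow_left₀ (by positivity) hq₂ l
    calc (r₀ * Λ ^ n₀) ^ θ * (Λ ^ θ) ^ l * t
        ≤ (r₀ * Λ ^ n₀) ^ θ * (Λ ^ θ) ^ l * (S / Λ ^ l) := by gcongr
      _ ≤ (r₀ * Λ ^ n₀) ^ θ * (q ^ l * Λ ^ l) * (S / Λ ^ l) := by gcongr
      _ = _ := by field_simp

/-- The superposition of one function per scale `r₀ * Λ ^ n`, weighted by the scale to the power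
`θ`: its increment between two points is, up to a small error, that of the scale comparable to
their distance. The series is normalised at a base point in order to converge. -/
lemma exists_scale_superposition {X : Type*} [MetricSpace X] [Nonempty X] {r₀ Λ θ q : ℝ}
    (hr₀ : 0 < r₀) (hΛ : 0 < Λ) (hq : 0 < q) (hq1 : q < 1)
    (hq₁ : 1 ≤ q * Λ ^ θ) (hq₂ : Λ ^ θ ≤ q * Λ) (g : ℤ → X → ℝ)
    (hg2 : ∀ n x y, |g n x - g n y| ≤ 2)
    (hgd : ∀ n x y, |g n x - g n y| ≤ dist x y / (r₀ * Λ ^ n)) :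
    ∃ F : X → ℝ, ∀ (x y : X) (n₀ : ℤ) (S : ℝ), 2 ≤ S → dist x y ≤ S * (r₀ * Λ ^ n₀) →
      |F x - F y - (r₀ * Λ ^ n₀) ^ θ * (g n₀ x - g n₀ y)| ≤
        S * (r₀ * Λ ^ n₀) ^ θ * (2 * q / (1 - q)) := by
  obtain ⟨x₀⟩ := ‹Nonempty X›
  have key : ∀ (x y : X) (n₀ : ℤ) (S : ℝ), 2 ≤ S → dist x y ≤ S * (r₀ * Λ ^ n₀) →
      Summable (fun n => (r₀ * Λ ^ n) ^ θ * (g n x - g n y)) ∧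
      |∑' n, (r₀ * Λ ^ n) ^ θ * (g n x - g n y) - (r₀ * Λ ^ n₀) ^ θ * (g n₀ x - g n₀ y)| ≤
        S * (r₀ * Λ ^ n₀) ^ θ * (2 * q / (1 - q)) := by
    intro x y n₀ S hS hd
    refine summable_and_abs_tsum_sub_le (a := fun n => (r₀ * Λ ^ n) ^ θ * (g n x - g n y))
      hq.le hq1 fun n => ?_
    have hpos : 0 ≤ (r₀ * Λ ^ n) ^ θ := by positivity
    rw [abs_mul, abs_of_nonneg hpos]
    exact scale_contribution_le hr₀ hΛ hq hq₁ hq₂ n n₀ (hg2 n x y) (hgd n x y) hS hd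
  have hsum : ∀ x, Summable (fun n => (r₀ * Λ ^ n) ^ θ * (g n x - g n x₀)) := fun x => by
    refine (key x x₀ 0 (2 + dist x x₀ / r₀) ?_ ?_).1
    · have : 0 ≤ dist x x₀ / r₀ := by positivity
      linarith
    · rw [zpow_zero, mul_one, add_mul, div_mul_cancel₀ _ hr₀.ne']
      linarith
  refine ⟨fun x => ∑' n, (r₀ * Λ ^ n) ^ θ * (g n x - g n x₀), fun x y n₀ S hS hd => ?_⟩
  have e : ∑' n, (r₀ * Λ ^ n) ^ θ * (g n x - g n x₀) - ∑' n, (r₀ * Λ ^ n) ^ θ * (g n y - g n x₀)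
      = ∑' n, (r₀ * Λ ^ n) ^ θ * (g n x - g n y) := by
    rw [← (hsum x).tsum_sub (hsum y)]
    exact tsum_congr fun n => by ring
  simp only [e]
  exact (key x y n₀ S hS hd).2

/-! ### The Assouad embedding -/

/-- A ratio `2 ^ m` of scales for which `exists_scale_superposition` applies with `q = 1 / 25`, that
is, with the relative error `2 * q / (1 - q) = 1 / 12`. -/
lemma exists_scale_ratio {θ : ℝ} (hθ : 0 < θ) (hθ1 : θ < 1) :
    ∃ m : ℕ, 0 < m ∧ 1 ≤ (1 / 25 : ℝ) * ((2 : ℝ) ^ m) ^ θ ∧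
      ((2 : ℝ) ^ m) ^ θ ≤ (1 / 25 : ℝ) * (2 : ℝ) ^ m := by
  have h2 : Filter.Tendsto (fun m : ℕ => (2 : ℝ) ^ m) Filter.atTop Filter.atTop :=
    tendsto_pow_atTop_atTop_of_one_lt one_lt_two
  have h3 := ((tendsto_rpow_atTop hθ).comp h2).eventually_ge_atTop 25
  have h4 := ((tendsto_rpow_atTop (sub_pos.2 hθ1)).comp h2).eventually_ge_atTop 25
  obtain ⟨m, ⟨h3, h4⟩, hm⟩ := ((h3.and h4).and (Filter.eventually_gt_atTop 0)).exists
  simp only [Function.comp_apply] at h3 h4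
  refine ⟨m, hm, by linarith, ?_⟩
  have e : (2 : ℝ) ^ m = ((2 : ℝ) ^ m) ^ θ * ((2 : ℝ) ^ m) ^ (1 - θ) := by
    rw [← Real.rpow_add (by positivity), add_sub_cancel, Real.rpow_one]
  have hpos : 0 < ((2 : ℝ) ^ m) ^ θ := by positivity
  nlinarith

/-- The coordinates of the embedding are indexed by the residue of the scale exponent modulo `m`
and by the class of the bump. -/
lemma HasPackingBound.exists_coordinates {X : Type*} [MetricSpace X] [Nonempty X] {k m : ℕ}
    (hk : HasPackingBound X k) {θ : ℝ} (hθ : 0 < θ) (hθ1 : θ < 1) (hm : 0 < m)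
    (hm₁ : 1 ≤ (1 / 25 : ℝ) * ((2 : ℝ) ^ m) ^ θ)
    (hm₂ : ((2 : ℝ) ^ m) ^ θ ≤ (1 / 25 : ℝ) * (2 : ℝ) ^ m) :
    ∃ F : Fin m × Fin k → X → ℝ,
      (∀ i x y, |F i x - F i y| ≤ 4 * 2 ^ m * dist x y ^ θ) ∧
      ∀ x y, x ≠ y → ∃ i, dist x y ^ θ ≤ 12 * |F i x - F i y| := by
  have hr : ∀ (i : Fin m) (n : ℤ), (0 : ℝ) < 2 ^ (i : ℕ) * (2 ^ m) ^ n := fun i n => by positivity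
  choose g hg2 hgd hgsep using fun (i : Fin m) (n : ℤ) => hk.exists_bumps (hr i n)
  choose F hF using fun i : Fin m × Fin k =>
    exists_scale_superposition (X := X) (r₀ := 2 ^ (i.1 : ℕ)) (Λ := 2 ^ m) (θ := θ) (q := 1 / 25)
      (by positivity) (by positivity) (by norm_num) (by norm_num) hm₁ hm₂ (fun n => g i.1 n i.2)
      (fun n => hg2 i.1 n i.2) (fun n => hgd i.1 n i.2)
  have hΛ1 : (1 : ℝ) < 2 ^ m := one_lt_pow₀ one_lt_two hm.ne'
  refine ⟨F, fun i x y => ?_, fun x y hxy => ?_⟩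
  · rcases eq_or_ne x y with rfl | hxy
    · rw [sub_self, abs_zero]; positivity
    have hd : 0 < dist x y := dist_pos.2 hxy
    -- Consecutive scales of one residue differ by the factor `2 ^ m`, so one of them lies within that
    -- factor below the distance.
    obtain ⟨n, hn1, hn2⟩ := exists_mem_Ico_zpow (x := dist x y / 2 ^ (i.1 : ℕ)) (y := 2 ^ m)
      (by positivity) hΛ1
    rw [le_div_iff₀' (by positivity)] at hn1
    rw [div_lt_iff₀' (by positivity), zpow_add_one₀ (by positivity)] at hn2
    have h1 := hF i x y n (2 * 2 ^ m) (by linarith) (by nlinarith)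
    have h2 := hg2 i.1 n i.2 x y
    set R : ℝ := 2 ^ (i.1 : ℕ) * (2 ^ m) ^ n with hR
    have hR0 : 0 < R := hr i.1 n
    have hRd : R ^ θ ≤ dist x y ^ θ := Real.rpow_le_rpow hR0.le hn1 hθ.le
    have hRθ : 0 < R ^ θ := by positivity
    have h3 : |R ^ θ * (g i.1 n i.2 x - g i.1 n i.2 y)| ≤ R ^ θ * 2 := by
      rw [abs_mul, abs_of_pos hRθ]
      gcongr
    have h4 : |F i x - F i y| ≤ 4 * 2 ^ m * R ^ θ := by
      have h5 := abs_sub_abs_le_abs_sub (F i x - F i y) (R ^ θ * (g i.1 n i.2 x - g i.1 n i.2 y))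
      norm_num at h1
      nlinarith
    exact h4.trans (by gcongr)
  · have hd : 0 < dist x y := dist_pos.2 hxy
    obtain ⟨j, hj1, hj2⟩ := exists_mem_Ico_zpow (x := dist x y / 3) (y := (2 : ℝ))
      (by positivity) one_lt_two
    rw [zpow_add_one₀ two_ne_zero] at hj2
    have hm' : (0 : ℤ) < m := by exact_mod_cast hm
    have hmod0 := Int.emod_nonneg j hm'.ne'
    have hmod1 := Int.emod_lt_of_pos j hm'
    let i : Fin m := ⟨(j % m).toNat, by omega⟩
    have hscale : (2 : ℝ) ^ (i : ℕ) * (2 ^ m) ^ (j / m) = 2 ^ j := by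
      rw [← zpow_natCast, ← zpow_natCast, ← zpow_mul, ← zpow_add₀ two_ne_zero]
      congr 1
      simp only [i, Int.toNat_of_nonneg hmod0]
      exact Int.emod_add_mul_ediv j m
    obtain ⟨c, hc⟩ := hgsep i (j / m) x y (by rw [hscale]; linarith) (by rw [hscale]; linarith)
    refine ⟨(i, c), ?_⟩
    -- With `S = 6` the error is half of the increment at the scale `2 ^ j`.
    have h1 := hF (i, c) x y (j / m) 6 (by norm_num) (by simp only [hscale]; linarith)
    simp only [hscale] at h1
    have hRθ : 0 < ((2 : ℝ) ^ j) ^ θ := by positivity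
    have h3 : ((2 : ℝ) ^ j) ^ θ ≤ |((2 : ℝ) ^ j) ^ θ * (g i (j / m) c x - g i (j / m) c y)| := by
      rw [abs_mul, abs_of_pos hRθ]
      exact le_mul_of_one_le_right hRθ.le hc
    have h4 : ((2 : ℝ) ^ j) ^ θ ≤ 2 * |F (i, c) x - F (i, c) y| := by
      have h5 := abs_sub_abs_le_abs_sub (((2 : ℝ) ^ j) ^ θ * (g i (j / m) c x - g i (j / m) c y))
        (F (i, c) x - F (i, c) y)
      rw [abs_sub_comm] at h1
      norm_num at h1
      linarith
    have h6 : dist x y ^ θ ≤ 6 * ((2 : ℝ) ^ j) ^ θ := by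
      calc dist x y ^ θ ≤ (6 * 2 ^ j) ^ θ := Real.rpow_le_rpow hd.le (by linarith) hθ.le
        _ = 6 ^ θ * ((2 : ℝ) ^ j) ^ θ := Real.mul_rpow (by norm_num) (by positivity)
        _ ≤ 6 * ((2 : ℝ) ^ j) ^ θ := by
          gcongr
          exact Real.rpow_le_self_of_one_le (by norm_num) hθ1.le
    linarith

lemma EuclideanSpace.norm_le_of_forall_abs_le {N : ℕ} (v : EuclideanSpace ℝ (Fin N)) {M : ℝ}
    (hM : 0 ≤ M) (h : ∀ i, |v i| ≤ M) : ‖v‖ ≤ (N + 1) * M := by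
  rw [EuclideanSpace.norm_eq, Real.sqrt_le_iff]
  refine ⟨by positivity, ?_⟩
  calc ∑ i, ‖v i‖ ^ 2 ≤ ∑ _i : Fin N, M ^ 2 := Finset.sum_le_sum fun i _ => by
        rw [Real.norm_eq_abs]; exact pow_le_pow_left₀ (abs_nonneg _) (h i) 2
    _ = N * M ^ 2 := by simp
    _ ≤ (N + 1) ^ 2 * M ^ 2 := by
        gcongr
        nlinarith [(Nat.cast_nonneg N : (0 : ℝ) ≤ N)]
    _ = ((N + 1) * M) ^ 2 := by ring

/-- **Assouad's embedding theorem**, with dimension and distortion controlled by the packing bound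
and the exponent. -/
theorem exists_assouad_embedding (k : ℕ) {θ : ℝ} (hθ : 0 < θ) (hθ1 : θ < 1) :
    ∃ (N : ℕ) (K : ℝ≥0), 0 < K ∧ ∀ (X : Type*) [MetricSpace X], HasPackingBound X k →
      ∃ f : X → EuclideanSpace ℝ (Fin N), ∀ x y,
        K⁻¹ * nndist x y ^ θ ≤ nndist (f x) (f y) ∧ nndist (f x) (f y) ≤ K * nndist x y ^ θ := by
  obtain ⟨m, hm, hm₁, hm₂⟩ := exists_scale_ratio hθ hθ1
  let N := Fintype.card (Fin m × Fin k)
  refine ⟨N, 12 + (N + 1) * (4 * 2 ^ m), by positivity, fun X _ hk => ?_⟩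
  rcases isEmpty_or_nonempty X with hX | hX
  · exact ⟨fun _ => 0, fun x => hX.elim x⟩
  obtain ⟨F, hup, hlow⟩ := hk.exists_coordinates hθ hθ1 hm hm₁ hm₂
  let e : Fin m × Fin k ≃ Fin N := Fintype.equivFin _
  let f : X → EuclideanSpace ℝ (Fin N) := fun x => WithLp.toLp 2 fun i => F (e.symm i) x
  refine ⟨f, fun x y => ⟨?_, ?_⟩⟩
  · rcases eq_or_ne x y with rfl | hxy
    · simp [NNReal.zero_rpow hθ.ne']
    obtain ⟨i, hi⟩ := hlow x y hxy
    have h1 : |F i x - F i y| ≤ dist (f x) (f y) := by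
      rw [dist_eq_norm]
      have := PiLp.norm_apply_le (f x - f y) (e i)
      simpa [f] using this
    rw [inv_mul_le_iff₀ (by positivity), ← NNReal.coe_le_coe]
    push_cast
    have h2 : (0 : ℝ) ≤ (N + 1) * (4 * 2 ^ m) * dist (f x) (f y) := by positivity
    linarith
  · rw [← NNReal.coe_le_coe]
    push_cast
    have h1 : dist (f x) (f y) ≤ (N + 1) * (4 * 2 ^ m * dist x y ^ θ) := by
      rw [dist_eq_norm]
      exact EuclideanSpace.norm_le_of_forall_abs_le _ (by positivity) fun i => hup (e.symm i) x y
    have h2 : 0 ≤ dist x y ^ θ := by positivity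
    linarith

/-! ### Sampling of Ahlfors regular spaces -/

/-- If `σ` is comparable to the snowflake `d ^ θ`, and `ρ` to `d ^ t`, then `σ` is comparable to
`ρ ^ (θ / t)`. -/
lemma NNReal.comparable_rpow_div {K c₁ c₂ d ρ σ : ℝ≥0} {θ t : ℝ} (hK : 0 < K) (hc₁ : 0 < c₁)
    (hθ : 0 < θ) (ht : 0 < t) (h₁ : K⁻¹ * d ^ θ ≤ σ) (h₂ : σ ≤ K * d ^ θ)
    (h₃ : c₁ * d ^ t ≤ ρ) (h₄ : ρ ≤ c₂ * d ^ t) :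
    (K * max c₁⁻¹ c₂ ^ (θ / t))⁻¹ * ρ ^ (θ / t) ≤ σ ∧
      σ ≤ K * max c₁⁻¹ c₂ ^ (θ / t) * ρ ^ (θ / t) := by
  have hp : 0 ≤ θ / t := by positivity
  have hc : 0 < max c₁⁻¹ c₂ := lt_max_of_lt_left (by positivity)
  have e : ∀ c : ℝ≥0, (c * d ^ t) ^ (θ / t) = c ^ (θ / t) * d ^ θ := fun c => by
    rw [NNReal.mul_rpow, ← NNReal.rpow_mul, mul_div_cancel₀ _ ht.ne']
  constructor
  · have h5 : ρ ^ (θ / t) ≤ max c₁⁻¹ c₂ ^ (θ / t) * d ^ θ := by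
      rw [← e]
      exact NNReal.rpow_le_rpow (h₄.trans (by gcongr; exact le_max_right _ _)) hp
    rw [inv_mul_le_iff₀ (by positivity)]
    rw [inv_mul_le_iff₀ hK] at h₁
    calc ρ ^ (θ / t) ≤ max c₁⁻¹ c₂ ^ (θ / t) * d ^ θ := h5
      _ ≤ max c₁⁻¹ c₂ ^ (θ / t) * (K * σ) := by gcongr
      _ = _ := by ring
  · have h5 : d ^ t ≤ max c₁⁻¹ c₂ * ρ := by
      calc d ^ t = c₁⁻¹ * (c₁ * d ^ t) := by field_simp
        _ ≤ max c₁⁻¹ c₂ * ρ := by gcongr; exact le_max_left _ _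
    have h6 : d ^ θ ≤ max c₁⁻¹ c₂ ^ (θ / t) * ρ ^ (θ / t) := by
      rw [← NNReal.mul_rpow]
      calc d ^ θ = (d ^ t) ^ (θ / t) := by
            rw [← NNReal.rpow_mul, mul_div_cancel₀ _ ht.ne']
        _ ≤ _ := NNReal.rpow_le_rpow h5 hp
    calc σ ≤ K * d ^ θ := h₂
      _ ≤ K * (max c₁⁻¹ c₂ ^ (θ / t) * ρ ^ (θ / t)) := by gcongr
      _ = _ := by ring

/-- The data of the sampling equivalences with respect to the distance functions comparable to
`q_{μ,s}`, uniformly over all spaces and all `θ`-snowflake embeddings with constant `K`. -/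
lemma exists_measureQuasimetric_data {α θ : ℝ} {C₀ K : ℝ≥0} (hα : 0 < α) (hC₀ : 0 < C₀)
    (hθ : 0 < θ) (hK : 0 < K) (s : ℝ) (C : ℝ≥0) :
    ∃ (η η' : ℝ≥0 ≃ₜ ℝ≥0) (L : ℝ≥0), 0 < L ∧ (0 < s → 1 ≤ C →
      ∀ (X Y : Type*) [MetricSpace X] [MeasurableSpace X] [MetricSpace Y] [Nontrivial X]
        (μ : Measure X) (f : X ≃ Y), IsAhlforsRegular μ α C₀ →
        (∀ x y, K⁻¹ * nndist x y ^ θ ≤ nndist (f x) (f y) ∧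
          nndist (f x) (f y) ≤ K * nndist x y ^ θ) →
        ∀ ρ : X → X → ℝ≥0, IsBilipEquiv C ρ (measureQuasimetric μ s) →
          IsSamplingEquiv ρ (fun u v : Y => nndist u v) η η' L (θ / (α * s)) f) := by
  by_cases hsC : 0 < s ∧ 1 ≤ C
  · obtain ⟨hs, hC⟩ := hsC
    have hC' : 0 < C := zero_lt_one.trans_le hC
    have hc₁ : 0 < C⁻¹ * (2 * C₀⁻¹) ^ s := by positivity
    have hc : 0 < max (C⁻¹ * (2 * C₀⁻¹) ^ s)⁻¹ (C * (2 * C₀) ^ s) :=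
      lt_max_of_lt_left (by positivity)
    have hK' : 0 < K * max (C⁻¹ * (2 * C₀⁻¹) ^ s)⁻¹ (C * (2 * C₀) ^ s) ^ (θ / (α * s)) := by
      positivity
    have hp : 0 < θ / (α * s) := by positivity
    refine ⟨_, _, _, ?_, fun _ _ X Y _ _ _ _ μ f hμ hf ρ hρ =>
      isSamplingEquiv_of_comparable hK' hp fun x y => ?_⟩
    · exact lt_max_of_lt_left hK'
    · have hq := hμ.measureQuasimetric_comparable hα hs x y
      refine NNReal.comparable_rpow_div hK hc₁ hθ (mul_pos hα hs) (hf x y).1 (hf x y).2 ?_ ?_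
      · refine le_trans ?_ (hρ x y).1
        rw [mul_assoc]
        gcongr
        exact hq.1
      · refine (hρ x y).2.trans ?_
        rw [mul_assoc]
        gcongr
        exact hq.2
  · -- For the remaining parameters nothing but `0 < L` is required.
    exact ⟨Homeomorph.refl _, Homeomorph.refl _, 1, one_pos, fun hs hC => absurd ⟨hs, hC⟩ hsC⟩

theorem mainTheorem2 (α θ : ℝ) (C₀ : ℝ≥0) (hα : 0 < α) (hC₀ : 0 < C₀) (hθ : 0 < θ) (hθ1 : θ < 1) :
    ∃ (N : ℕ) (η η' : ℝ≥0 ≃ₜ ℝ≥0) (L : ℝ≥0)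
      (ηq ηq' : ℝ → ℝ≥0 → (ℝ≥0 ≃ₜ ℝ≥0)) (Lq : ℝ → ℝ≥0 → ℝ≥0),
      0 < L ∧ (∀ s C, 0 < Lq s C) ∧
      ∀ (X : Type*) [MetricSpace X] [MeasurableSpace X] [BorelSpace X]
        (μ : Measure X), IsAhlforsRegular μ α C₀ →
        ∃ (Y : Set (EuclideanSpace ℝ (Fin N))) (f : X ≃ Y),
          -- sampling with respect to the original metric
          IsSamplingEquiv (fun x y : X => nndist x y) (fun u v : Y => nndist u v)
            η η' L θ f ∧
          -- if `X` has at least two points: sampling with respect to `q_{μ,s}`, and to every (quasi)metric bilipschitz to it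
          (Nontrivial X → ∀ (s : ℝ), 0 < s → ∀ (C : ℝ≥0), 1 ≤ C → ∀ (ρ : X → X → ℝ≥0),
            IsBilipEquiv C ρ (measureQuasimetric μ s) →
            IsSamplingEquiv ρ (fun u v : Y => nndist u v)
              (ηq s C) (ηq' s C) (Lq s C) (θ / (α * s)) f) := by
  obtain ⟨N, K, hK, hemb⟩ := exists_assouad_embedding (⌈C₀ ^ 2 * 30 ^ α⌉₊ + 1) hθ hθ1
  choose ηq ηq' Lq hLq hq using exists_measureQuasimetric_data hα hC₀ hθ hK
  refine ⟨N, powerHomeomorph (K ^ 2) (by positivity) θ hθ,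
    powerHomeomorph ((K ^ (1 / θ)) ^ 2) (by positivity) (1 / θ) (by positivity),
    max K (K ^ (1 / θ)), ηq, ηq', Lq, lt_max_of_lt_left hK, hLq, fun X _ _ _ μ hμ => ?_⟩
  obtain ⟨f, hf⟩ := hemb X (hμ.hasPackingBound hα hC₀)
  have hinj : Function.Injective f := fun x y hxy => by
    have h := (hf x y).1
    rw [hxy, nndist_self, nonpos_iff_eq_zero, mul_eq_zero, NNReal.rpow_eq_zero_iff] at h
    exact nndist_eq_zero.1 (h.resolve_left (inv_ne_zero hK.ne')).1
  exact ⟨Set.range f, Equiv.ofInjective f hinj, isSamplingEquiv_of_comparable hK hθ hf,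
    fun _ s hs C hC ρ hρ => hq s C hs hC X _ μ _ hμ hf ρ hρ⟩
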